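/- Consider a household with initial capital $x\ge 0$ and poverty line $x^*>0$. Let $0=\tau_0<\tau_1<\tau_2<\dots$ where $(\tau_i)_{i\ge1}$ are the arrival times of a Poisson process of intensity $\lambda>0$ (i.e. the waiting times $\tau_{i}-\tau_{i-1}$ are i.i.d. exponential with rate $\lambda$), and let $(Z_i)_{i\ge 1}$ be i.i.d. with $Z_i\sim\mathrm{Beta}(\alpha,1)$, $\alpha>0$ (density $\alpha z^{\alpha-1}$ on $(0,1)$), independent of $(\tau_i)_{i\ge 1}$. Between loss events the capital follows $dX_t=r[X_t-x^*]^+dt$ with $r>0$; at time $\tau_i$ it is multiplied by $Z_i$. Whenever the capital is below $x^*$ (at time $0$ or after a loss) a lump-sum transfer immediately raises it to exactly $x^*$. Thus, if $X_i$ denotes the capital at time $\tau_i$ just before a possible transfer, then $$X_0=x,\qquad X_{i+1}=\Big[\big(\max(X_i,x^*)-x^*\big)e^{r(\tau_{i+1}-\tau_i)}+x^*\Big]Z_{i+1}.$$ For a discount rate $\delta>0$ the cost of social protection is the expected total of the discounted transfers, $$C(x)=\mathbb E\Big[\sum_{i\ge 0}e^{-\delta\tau_i}\,(x^*-X_i)^+\Big].$$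 Put $$a=\frac{-(\delta+\lambda-\alpha r)-\sqrt{(\delta+\lambda-\alpha r)^2+4r\alpha\delta}}{2r},\qquad b=\frac{-(\delta+\lambda-\alpha r)+\sqrt{(\delta+\lambda-\alpha r)^2+4r\alpha\delta}}{2r},\qquad c=\alpha,$$ and let ${}_2F_1$ be the Gauss hypergeometric function, ${}_2F_1(p,q;m;s)=\sum_{n\ge0}\frac{(p)_n(q)_n}{(m)_n}\frac{s^n}{n!}$. Then the series of ${}_2F_1(b,b-c+1;b-a+1;s)$ converges for all $s\in[0,1]$, its value at $s=1$ is nonzero, $C(x)$ is finite for every $x\ge0$, and $$C(x)=\begin{cases}(x^*-x)+\dfrac{\lambda x^*}{(\alpha+1)\delta}, & 0\le x\le x^*,\\[3mm]\dfrac{{}_2F_1\!\left(b,b-c+1;b-a+1;\frac{x^*}{x}\right)\lambda x^*}{{}_2F_1\!\left(b,b-c+1;b-a+1;1\right)(\alpha+1)\delta}\left(\dfrac{x^*}{x}\right)^{b}, & x>x^*.\end{cases}$$ -/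

import Mathlib

open MeasureTheory ProbabilityTheory
open scoped ENNReal

/-- The driving randomness of the model on the probability space `(Ω, P)`.

`τ 0 = 0`, and `τ n` for `n ≥ 1` is the time of the `n`-th loss event: these are the arrival times
of a Poisson process of intensity `lam`, that is, the waiting times `τ (n + 1) - τ n` are
independent and exponentially distributed with rate `lam`.

`Z n` is the proportion of the capital that remains after the loss event at time `τ (n + 1)`:
these are independent, with common law `G`, and the whole sequence is independent
of the sequence of loss times (equivalently, of the counting process of the losses). -/
structure IsLossModel {Ω : Type*} [MeasurableSpace Ω] (P : Measure Ω) (lam : ℝ) (G : Measure ℝ)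
    (τ Z : ℕ → Ω → ℝ) : Prop where
  measurable_time : ∀ n, Measurable (τ n)
  time_zero : ∀ ω, τ 0 ω = 0
  waiting_law : ∀ n, HasLaw (fun ω => τ (n + 1) ω - τ n ω) (expMeasure lam) P
  waiting_indep : iIndepFun (fun n ω => τ (n + 1) ω - τ n ω) P
  measurable_remaining : ∀ n, Measurable (Z n)
  remaining_law : ∀ n, HasLaw (Z n) G P
  remaining_indep : iIndepFun Z P
  indep : IndepFun (fun ω n => τ n ω) (fun ω n => Z n ω) P

/-- The capital at time `s` after a time at which it was `y`, if there is no loss and no transfer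
in between: the solution of `dX = r [X - xs]⁺ ds`, `X 0 = y`. -/
noncomputable def capitalFlow (r xs y s : ℝ) : ℝ :=
  if xs < y then (y - xs) * Real.exp (r * s) + xs else y

/-- The capital of the household at time `t n` immediately *before* the transfer made at that time,
for loss times `t`, remaining proportions `z` and initial capital `x`, when every shortfall of the
capital below the poverty line `xs` is immediately made up by a transfer which lifts the capital
to exactly `xs` (so the capital after the transfer is `max (capitalBeforeTransfer …) xs`), and no
other transfers are made. Index `0` is the start, before a possible transfer at time `0`;
index `n ≥ 1` is the capital just after the `n`-th loss. -/
noncomputable def capitalBeforeTransfer (r xs : ℝ) (t z : ℕ → ℝ) (x : ℝ) : ℕ → ℝ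
  | 0 => x
  | n + 1 =>
      capitalFlow r xs (max (capitalBeforeTransfer r xs t z x n) xs) (t (n + 1) - t n) * z n

/-- The transfer made at time `t n`: the shortfall of the capital below the poverty line `xs`. -/
noncomputable def transfer (r xs : ℝ) (t z : ℕ → ℝ) (x : ℝ) (n : ℕ) : ℝ :=
  max (xs - capitalBeforeTransfer r xs t z x n) 0

/-- The cost of social protection `C(x)`: the expected discounted (at rate `δ`) total of the
capital transfers which keep the household's capital from falling below the poverty line `xs`,
for initial capital `x`. As an expectation of a nonnegative quantity it has values in `[0, ∞]`. -/
noncomputable def socialProtectionCost {Ω : Type*} [MeasurableSpace Ω] (P : Measure Ω)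
    (r xs δ : ℝ) (τ Z : ℕ → Ω → ℝ) (x : ℝ) : ℝ≥0∞ :=
  ∫⁻ ω, ∑' n, ENNReal.ofReal
    (Real.exp (-δ * τ n ω) * transfer r xs (fun k => τ k ω) (fun k => Z k ω) x n) ∂P

/-! The cost solves a one-step equation: transfer now, plus the discounted expected cost just after
the next loss. Iterating it `N` times on a bounded solution leaves a remainder of size at most `M *
(lam / (lam + δ)) ^ N`, so a bounded solution must be the expected discounted sum of its source
(`tendsto_sum_integral_discounted`). It remains to exhibit one.

With `u = x / xs`, let `V` be the value above the poverty line and `W` its `Beta(α, 1)`-average over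
the next loss. The density `α z ^ (α - 1)` gives `u W' = α (V - W)`; the exponential waiting time
gives `lam W = (δ + lam) V - r (u - 1) V'`. For `V = ∑ c n * u ^ (-(b + n))` this system reduces to
the hypergeometric recurrence, since eliminating `W` produces the indicial polynomial `r (ρ - a) (ρ
- b)`. Below the line the value is affine with slope `-B`, and matching `W` at `u = 1` fixes `B`;
dividing by `B` normalizes the source to the transfer itself.

Two points are delicate. At `u = 1` the term `(u - 1) V'` must drop out, which follows from `n * c n
→ 0` (`tsum_generatorCoeff`). And `V 1 ≠ 0` comes from uniqueness rather than from Gauss's formula: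
if `V 1 = 0` then `B = 0`, the source vanishes, hence `V = 0` and `c 0 = 0`, whereas `c 0 = 1`. -/

open Filter Topology

/-! ### Hypergeometric coefficients and their summability -/

/-- A form of Raabe's test for series with hypergeometric term ratio. -/
lemma summable_of_hypergeometric_ratio {c : ℕ → ℝ} {p q m : ℝ} (hm : 0 < m) (hpq : p + q < m)
    (hc : ∀ n : ℕ, c (n + 1) * ((m + n) * (n + 1)) = c n * ((p + n) * (q + n))) :
    Summable c := by
  -- Half of the Raabe gap `m - p - q`; the other half absorbs the constant terms `ε * m + p * q`
  -- once `n ≥ N`.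
  set ε : ℝ := (m - p - q) / 2 with hε
  have hε0 : 0 < ε := by rw [hε]; linarith
  obtain ⟨N, hN⟩ := exists_nat_ge (|p| + |q| + (ε * m + |p * q|) / ε)
  have hquot : 0 ≤ (ε * m + |p * q|) / ε := by positivity
  -- The right side telescopes, so the partial sums of the tail of `|c n|` are bounded by `N * |c N|
  -- / ε`.
  have key : ∀ n : ℕ, N ≤ n → ε * |c n| ≤ n * |c n| - ((n + 1 : ℕ) : ℝ) * |c (n + 1)| := by
    intro n hn
    have hn' : (N : ℝ) ≤ n := by exact_mod_cast hn
    have hp : 0 ≤ p + n := by linarith [neg_abs_le p, abs_nonneg q]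
    have hq : 0 ≤ q + n := by linarith [neg_abs_le q, abs_nonneg p]
    have hmn : 0 < m + n := by positivity
    have h1 : |c (n + 1)| * ((m + n) * (n + 1)) = |c n| * ((p + n) * (q + n)) := by
      rw [← abs_of_nonneg (show 0 ≤ (m + n) * ((n : ℝ) + 1) by positivity),
        ← abs_of_nonneg (mul_nonneg hp hq), ← abs_mul, ← abs_mul, hc]
    have h2 : (ε * m + |p * q|) ≤ ε * n := by
      have : (ε * m + |p * q|) / ε ≤ n := by linarith [abs_nonneg p, abs_nonneg q]
      rw [div_le_iff₀ hε0] at this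
      linarith
    have h3 : (p + n) * (q + n) ≤ (n - ε) * (m + n) := by
      have : m = 2 * ε + p + q := by rw [hε]; ring
      have h4 : (n - ε) * (m + n) - (p + n) * (q + n) = ε * n - ε * m - p * q := by
        rw [this]; ring
      linarith [le_abs_self (p * q)]
    have h5 : |c n| * ((p + n) * (q + n)) ≤ |c n| * ((n - ε) * (m + n)) :=
      mul_le_mul_of_nonneg_left h3 (abs_nonneg _)
    have h6 : (((n : ℝ) + 1) * |c (n + 1)|) * (m + n) ≤ ((n - ε) * |c n|) * (m + n) := by
      linarith
    have h7 := le_of_mul_le_mul_right h6 hmn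
    push_cast
    linarith
  have hs : Summable fun k => |c (k + N)| := by
    refine summable_of_sum_range_le (c := N * |c N| / ε) (fun _ => abs_nonneg _) fun K => ?_
    rw [le_div_iff₀ hε0]
    have : ∀ K : ℕ, (∑ k ∈ Finset.range K, |c (k + N)|) * ε
        ≤ N * |c N| - ((K + N : ℕ) : ℝ) * |c (K + N)| := by
      intro K
      induction K with
      | zero => simp
      | succ K ih =>
        rw [Finset.sum_range_succ, add_mul]
        have := key (K + N) (by omega)
        rw [show K + 1 + N = K + N + 1 by ring]
        linarith
    exact (this K).trans (sub_le_self _ (by positivity))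
  exact ((summable_nat_add_iff N).1 hs).of_abs

lemma ordinaryHypergeometricCoefficient_succ_mul {p q m : ℝ} (hm : 0 < m) (n : ℕ) :
    ordinaryHypergeometricCoefficient p q m (n + 1) * ((m + n) * (n + 1)) =
      ordinaryHypergeometricCoefficient p q m n * ((p + n) * (q + n)) := by
  have h1 : (ascPochhammer ℝ n).eval m ≠ 0 := (ascPochhammer_pos n m hm).ne'
  have h2 : m + n ≠ 0 := by positivity
  have h3 : (n.factorial : ℝ) ≠ 0 := by positivity
  have h4 : (n : ℝ) + 1 ≠ 0 := by positivity
  simp only [ordinaryHypergeometricCoefficient, ascPochhammer_succ_eval, Nat.factorial_succ,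
    Nat.cast_mul, Nat.cast_add, Nat.cast_one]
  field_simp

/-- If `c` is summable and `n * c n` converges, then its limit is `0`. -/
lemma eq_zero_of_tendsto_natCast_mul {c : ℕ → ℝ} (hc : Summable c) {L : ℝ}
    (hL : Tendsto (fun n : ℕ => n * c n) atTop (𝓝 L)) : L = 0 := by
  by_contra hne
  -- A nonzero limit would make `1 / n` of order `O(c n)`, so the harmonic series would converge.
  refine Real.not_summable_natCast_inv (summable_of_isBigO_nat hc.norm ?_)
  have h := hL.inv₀ hne
  have h1 : (fun n : ℕ => (n * c n)⁻¹) =O[atTop] fun _ => (1 : ℝ) := h.isBigO_one ℝ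
  have h2 := h1.mul (Asymptotics.isBigO_refl c atTop)
  refine (h2.congr' ?_ ?_).norm_right
  · filter_upwards [hL.eventually_ne hne] with n hn
    have : c n ≠ 0 := right_ne_zero_of_mul hn
    have : (n : ℝ) ≠ 0 := left_ne_zero_of_mul hn
    field_simp
  · exact Eventually.of_forall fun n => one_mul _

/-! ### Series in negative real powers on `[1, ∞)` -/

/-- The series `∑ c n * u ^ (-(b + n))`. -/
noncomputable def rpowSeries (b : ℝ) (c : ℕ → ℝ) (u : ℝ) : ℝ := ∑' n : ℕ, c n * u ^ (-(b + n))

section rpowSeries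

variable {b : ℝ} {c : ℕ → ℝ} {u : ℝ}

lemma abs_rpowSeries_term_le (hb : 0 ≤ b) (hu : 1 ≤ u) (n : ℕ) :
    |c n * u ^ (-(b + n))| ≤ |c n| := by
  rw [abs_mul, abs_of_nonneg (Real.rpow_nonneg (by linarith) _)]
  refine mul_le_of_le_one_right (abs_nonneg _) (Real.rpow_le_one_of_one_le_of_nonpos hu ?_)
  have : (0 : ℝ) ≤ n := n.cast_nonneg
  linarith

lemma summable_rpowSeries (hb : 0 ≤ b) (hc : Summable c) (hu : 1 ≤ u) :
    Summable fun n : ℕ => c n * u ^ (-(b + n)) :=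
  (Summable.of_nonneg_of_le (fun _ => abs_nonneg _) (abs_rpowSeries_term_le hb hu) hc.abs).of_abs

lemma abs_rpowSeries_le (hb : 0 ≤ b) (hc : Summable c) (hu : 1 ≤ u) :
    |rpowSeries b c u| ≤ ∑' n, |c n| := by
  refine tsum_of_norm_bounded (f := fun n : ℕ => c n * u ^ (-(b + n))) hc.abs.hasSum fun n => ?_
  exact abs_rpowSeries_term_le hb hu n

lemma continuousOn_rpowSeries (hb : 0 ≤ b) (hc : Summable c) :
    ContinuousOn (rpowSeries b c) (Set.Ici 1) := by
  refine continuousOn_tsum (fun n => ?_) hc.abs fun n u hu => abs_rpowSeries_term_le hb hu n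
  refine continuousOn_const.mul (continuousOn_id.rpow_const fun u hu => Or.inl ?_)
  exact (zero_lt_one.trans_le hu).ne'

lemma rpowSeries_one : rpowSeries b c 1 = ∑' n, c n := by simp [rpowSeries]

lemma rpowSeries_eq (hu : 0 < u) : rpowSeries b c u = (∑' n, c n * u⁻¹ ^ n) * u⁻¹ ^ b := by
  rw [rpowSeries, ← tsum_mul_right]
  refine tsum_congr fun n => ?_
  rw [neg_add, Real.rpow_add hu, Real.rpow_neg hu.le, Real.rpow_neg hu.le, Real.rpow_natCast,
    Real.inv_rpow hu.le, inv_pow]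
  ring

/-- Majorant for termwise differentiation on `(ρ, ∞)`: the geometric decay of `ρ⁻¹ ^ n` beats the
factor `b + n`. It needs `ρ > 1`, which is why derivatives are taken only on the open half-line. -/
lemma summable_mul_rpowSeries_deriv (hc : Summable c) {ρ : ℝ} (hρ : 1 < ρ) :
    Summable fun n : ℕ => |c n * -(b + n)| * ρ ^ (-(b + n) - 1) := by
  have h0 : 0 < ρ := by linarith
  have hg : Summable fun n : ℕ => (n : ℝ) ^ 1 * (ρ⁻¹) ^ n :=
    summable_pow_mul_geometric_of_norm_lt_one 1 (by
      rw [Real.norm_of_nonneg (by positivity)]; exact inv_lt_one_of_one_lt₀ hρ)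
  have hg0 : Summable fun n : ℕ => (ρ⁻¹) ^ n :=
    summable_geometric_of_lt_one (by positivity) (inv_lt_one_of_one_lt₀ hρ)
  obtain ⟨K, hK⟩ : ∃ K, ∀ n, |c n| ≤ K :=
    ⟨∑' n, |c n|, fun n => hc.abs.le_tsum n fun _ _ => abs_nonneg _⟩
  refine Summable.of_nonneg_of_le (fun n => by positivity) (fun n => ?_)
    (((hg0.mul_left |b|).add hg).mul_left (K * ρ ^ (-b - 1)))
  have h1 : ρ ^ (-(b + n) - 1) = ρ ^ (-b - 1) * ρ⁻¹ ^ n := by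
    rw [show -(b + n) - 1 = (-b - 1) + -(n : ℝ) by ring, Real.rpow_add h0, Real.rpow_neg h0.le n,
      Real.rpow_natCast, inv_pow]
  have h2 : |b + n| ≤ |b| + n := by
    refine (abs_add_le _ _).trans_eq ?_
    rw [abs_of_nonneg (n.cast_nonneg : (0 : ℝ) ≤ n)]
  rw [abs_mul, abs_neg, h1]
  calc |c n| * |b + n| * (ρ ^ (-b - 1) * ρ⁻¹ ^ n)
      ≤ K * (|b| + n) * (ρ ^ (-b - 1) * ρ⁻¹ ^ n) := by
        gcongr
        · exact (abs_nonneg _).trans (hK 0)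
        · exact hK n
    _ = _ := by ring

lemma abs_rpowSeries_deriv_term_le (hb : 0 ≤ b) {ρ : ℝ} (hρ : 0 < ρ) (hu : ρ ≤ u) (n : ℕ) :
    |c n * (-(b + n) * u ^ (-(b + n) - 1))| ≤ |c n * -(b + n)| * ρ ^ (-(b + n) - 1) := by
  rw [← mul_assoc, abs_mul, abs_of_nonneg (Real.rpow_nonneg (hρ.le.trans hu) _)]
  refine mul_le_mul_of_nonneg_left (Real.rpow_le_rpow_of_nonpos hρ hu ?_) (abs_nonneg _)
  have : (0 : ℝ) ≤ n := n.cast_nonneg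
  linarith

lemma summable_rpowSeries_deriv (hb : 0 ≤ b) (hc : Summable c) (hu : 1 < u) :
    Summable fun n : ℕ => c n * (-(b + n) * u ^ (-(b + n) - 1)) :=
  (Summable.of_nonneg_of_le (fun _ => abs_nonneg _)
    (abs_rpowSeries_deriv_term_le hb (by linarith) le_rfl)
    (summable_mul_rpowSeries_deriv hc hu)).of_abs

lemma hasDerivAt_rpowSeries (hb : 0 ≤ b) (hc : Summable c) (hu : 1 < u) :
    HasDerivAt (rpowSeries b c) (∑' n : ℕ, c n * (-(b + n) * u ^ (-(b + n) - 1))) u := by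
  obtain ⟨ρ, h1, h2⟩ := exists_between hu
  have hder : ∀ (n : ℕ) (y : ℝ), y ∈ Set.Ioi ρ → HasDerivAt (fun y : ℝ => c n * y ^ (-(b + n)))
      (c n * (-(b + n) * y ^ (-(b + n) - 1))) y := fun n y hy =>
    (Real.hasDerivAt_rpow_const
      (Or.inl (by have : ρ < y := hy; linarith : y ≠ 0))).const_mul _
  have hbd : ∀ (n : ℕ) (y : ℝ), y ∈ Set.Ioi ρ → ‖c n * (-(b + n) * y ^ (-(b + n) - 1))‖ ≤
      |c n * -(b + n)| * ρ ^ (-(b + n) - 1) := fun n y hy =>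
    abs_rpowSeries_deriv_term_le hb (by linarith) (le_of_lt hy) n
  exact hasDerivAt_tsum_of_isPreconnected (summable_mul_rpowSeries_deriv (b := b) hc h1)
    isOpen_Ioi isPreconnected_Ioi hder hbd h2 (summable_rpowSeries hb hc hu.le) h2

end rpowSeries

/-! ### The generator acting on coefficients -/

/-- Coefficients of the image of `rpowSeries b c` under `V ↦ (κ V - r (u - 1) V') / lam`. -/
noncomputable def generatorCoeff (r κ lam b : ℝ) (c : ℕ → ℝ) : ℕ → ℝ
  | 0 => (r * b + κ) * c 0 / lam
  | n + 1 => ((r * (b + (n + 1)) + κ) * c (n + 1) - r * (b + n) * c n) / lam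

section generatorCoeff

variable {r κ lam α b m : ℝ} {c : ℕ → ℝ}

/-- Coefficient form of `u W' = α (V - W)`. Substituting `hroot` leaves exactly the hypergeometric
recurrence. -/
lemma sub_mul_generatorCoeff (hlam : lam ≠ 0)
    (hroot : ∀ n : ℕ, (α - (b + n)) * (r * (b + n) + κ) = lam * α - r * ((m - 1 + n) * n))
    (hc : ∀ n : ℕ, c (n + 1) * ((m + n) * (n + 1)) = c n * ((b + n) * (b - α + 1 + n))) (n : ℕ) :
    (α - (b + n)) * generatorCoeff r κ lam b c n = α * c n := by
  cases n with
  | zero =>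
    have := hroot 0
    simp only [generatorCoeff, Nat.cast_zero, add_zero, mul_zero, sub_zero] at *
    rw [mul_div_assoc', div_eq_iff hlam, ← mul_assoc, this]
    ring
  | succ n =>
    have h1 := hroot (n + 1)
    have h2 := hc n
    simp only [generatorCoeff, Nat.cast_add, Nat.cast_one] at *
    rw [mul_div_assoc', div_eq_iff hlam]
    linear_combination c (n + 1) * h1 - r * h2

lemma summable_generatorCoeff (hc : Summable c)
    (hg : ∀ n : ℕ, (α - (b + n)) * generatorCoeff r κ lam b c n = α * c n) :
    Summable (generatorCoeff r κ lam b c) := by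
  -- Beyond this index `|α - (b + n)| ≥ 1`; for smaller `n` the factor may vanish, so only the tail
  -- is compared with `c`.
  obtain ⟨N, hN⟩ := exists_nat_ge (1 + α - b)
  rw [← summable_nat_add_iff N]
  refine Summable.of_norm_bounded (((summable_nat_add_iff N).2 hc).abs.mul_left |α|) fun n => ?_
  have h := congrArg abs (hg (n + N))
  rw [abs_mul, abs_mul] at h
  rw [Real.norm_eq_abs, ← h]
  refine le_mul_of_one_le_left (abs_nonneg _) ?_
  have : (0 : ℝ) ≤ n := n.cast_nonneg
  rw [abs_sub_comm]
  refine le_trans ?_ (le_abs_self _)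
  push_cast
  linarith

/-- The boundary condition at `u = 1`. Partial sums telescope up to the term `r * (b + n) * c n`;
hence `n * c n` converges, and summability of `c` forces its limit to be `0`. -/
lemma tsum_generatorCoeff (hlam : lam ≠ 0) (hr : r ≠ 0) (hc : Summable c)
    (hg : Summable (generatorCoeff r κ lam b c)) :
    lam * ∑' n, generatorCoeff r κ lam b c n = κ * ∑' n, c n := by
  have hsum : ∀ n : ℕ, lam * ∑ k ∈ Finset.range (n + 1), generatorCoeff r κ lam b c k =
      κ * ∑ k ∈ Finset.range (n + 1), c k + r * (b + n) * c n := by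
    intro n
    induction n with
    | zero => simp [generatorCoeff, mul_div_cancel₀ _ hlam]; ring
    | succ n ih =>
      rw [Finset.sum_range_succ, mul_add, ih, Finset.sum_range_succ _ (n + 1), generatorCoeff,
        mul_div_cancel₀ _ hlam]
      push_cast
      ring
  have h1 := ((tendsto_add_atTop_iff_nat 1).2 hg.hasSum.tendsto_sum_nat).const_mul lam
  have h2 := ((tendsto_add_atTop_iff_nat 1).2 hc.hasSum.tendsto_sum_nat).const_mul κ
  have h3 : Tendsto (fun n : ℕ => n * c n) atTop
      (𝓝 (r⁻¹ * (lam * ∑' n, generatorCoeff r κ lam b c n - κ * ∑' n, c n) - b * 0)) := by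
    refine ((((h1.sub h2).const_mul r⁻¹).sub
      (hc.tendsto_atTop_zero.const_mul b))).congr fun n => ?_
    rw [hsum n]
    field_simp
    ring
  have h4 := eq_zero_of_tendsto_natCast_mul hc h3
  rw [mul_zero, sub_zero, mul_eq_zero, or_iff_right (inv_ne_zero hr)] at h4
  linarith

lemma rpowSeries_generatorCoeff (hlam : lam ≠ 0) (hb : 0 ≤ b) (hc : Summable c) {u : ℝ}
    (hu : 1 < u) :
    lam * rpowSeries b (generatorCoeff r κ lam b c) u = κ * rpowSeries b c u -
      r * (u - 1) * ∑' n : ℕ, c n * (-(b + n) * u ^ (-(b + n) - 1)) := by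
  have hu0 : 0 < u := by linarith
  have hV := (summable_rpowSeries hb hc hu.le).hasSum
  have hd := (summable_rpowSeries_deriv hb hc hu).hasSum
  set D := ∑' n : ℕ, c n * (-(b + n) * u ^ (-(b + n) - 1)) with hD
  -- The series of `V'` shifted by one index, since `-(b + n) - 1 = -(b + (n + 1))`.
  set s : ℕ → ℝ := fun n => Nat.casesOn n 0 fun k => c k * (-(b + k) * u ^ (-(b + k) - 1)) with hs
  have hs' : HasSum s D := by
    rw [← hasSum_nat_add_iff' 1]
    simpa [hs] using hd
  have key := ((hV.mul_left κ).sub (hd.mul_left (r * u))).add (hs'.mul_left r)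
  have hterm : ∀ n : ℕ, κ * (c n * u ^ (-(b + n))) -
      r * u * (c n * (-(b + n) * u ^ (-(b + n) - 1))) + r * s n =
      lam * (generatorCoeff r κ lam b c n * u ^ (-(b + n))) := by
    intro n
    cases n with
    | zero =>
      rw [Real.rpow_sub_one hu0.ne']
      simp only [show s 0 = 0 from rfl, generatorCoeff, Nat.cast_zero, add_zero, mul_zero]
      field_simp
      ring
    | succ n =>
      have h1 : u ^ (-(b + n) - 1) = u ^ (-(b + (n + 1 : ℕ))) := by
        congr 1; push_cast; ring
      rw [Real.rpow_sub_one hu0.ne']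
      simp only [hs, generatorCoeff, h1]
      push_cast
      field_simp
      ring
  simp only [hterm] at key
  rw [rpowSeries, ← tsum_mul_left, key.tsum_eq, rpowSeries]
  ring

lemma mul_tsum_deriv_generatorCoeff (hb : 0 ≤ b) (hc : Summable c)
    (hg : ∀ n : ℕ, (α - (b + n)) * generatorCoeff r κ lam b c n = α * c n) {u : ℝ} (hu : 1 < u) :
    u * ∑' n : ℕ, generatorCoeff r κ lam b c n * (-(b + n) * u ^ (-(b + n) - 1)) =
      α * (rpowSeries b c u - rpowSeries b (generatorCoeff r κ lam b c) u) := by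
  have hu0 : 0 < u := by linarith
  have hgs := summable_generatorCoeff hc hg
  have h1 := (summable_rpowSeries hb hc hu.le).hasSum
  have h2 := (summable_rpowSeries hb hgs hu.le).hasSum
  have h3 := (h1.sub h2).mul_left α
  rw [← tsum_mul_left]
  refine Eq.trans (tsum_congr fun n => ?_) h3.tsum_eq
  rw [Real.rpow_sub_one hu0.ne']
  have := hg n
  field_simp
  linear_combination this

end generatorCoeff

/-! ### Integrals against the Beta and exponential laws -/

lemma integral_betaMeasure_one {α : ℝ} (hα : 0 < α) (f : ℝ → ℝ) :
    ∫ z, f z ∂(betaMeasure α 1) = ∫ z in (0 : ℝ)..1, α * z ^ (α - 1) * f z := by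
  have hbeta : 1 / beta α 1 = α := by
    rw [beta, Real.Gamma_one, Real.Gamma_add_one hα.ne']
    have := (Real.Gamma_pos_of_pos hα).ne'
    field_simp
  rw [betaMeasure, integral_withDensity_eq_integral_toReal_smul
    (by unfold betaPDF; fun_prop) (by simp [betaPDF]),
    intervalIntegral.integral_of_le zero_le_one, integral_Ioc_eq_integral_Ioo,
    ← integral_indicator measurableSet_Ioo]
  refine integral_congr_ae (Eventually.of_forall fun z => ?_)
  by_cases hz : 0 < z ∧ z < 1
  · have hz' : z ∈ Set.Ioo (0 : ℝ) 1 := hz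
    have h0 : 0 ≤ α * z ^ (α - 1) := mul_nonneg hα.le (Real.rpow_nonneg hz.1.le _)
    simp only [Set.indicator_of_mem hz', betaPDF, betaPDFReal, if_pos hz, hbeta, sub_self,
      Real.rpow_zero, mul_one, ENNReal.toReal_ofReal h0, smul_eq_mul]
  · simp [betaPDF, betaPDFReal, hz]

lemma integral_expMeasure {lam : ℝ} (hlam : 0 < lam) (f : ℝ → ℝ) :
    ∫ t, f t ∂(expMeasure lam) = ∫ t in Set.Ioi (0 : ℝ), lam * Real.exp (-(lam * t)) * f t := by
  have hm : Measurable (gammaPDF 1 lam) := by unfold gammaPDF; fun_prop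
  rw [expMeasure, gammaMeasure, integral_withDensity_eq_integral_toReal_smul hm
    (by simp [gammaPDF]), ← integral_Ici_eq_integral_Ioi, ← integral_indicator measurableSet_Ici]
  refine integral_congr_ae (Eventually.of_forall fun t => ?_)
  change (exponentialPDF lam t).toReal • f t = _
  rw [exponentialPDF_eq]
  by_cases ht : 0 ≤ t
  · have ht' : t ∈ Set.Ici (0 : ℝ) := ht
    rw [Set.indicator_of_mem ht', if_pos ht, ENNReal.toReal_ofReal (by positivity), smul_eq_mul]
  · simp [ht]

/-! ### Generator pairs and the one-step equation -/

/-- A bounded pair `V`, `W` on `[1, ∞)` such that `W` is the running `Beta(α, 1)`-average of `V`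
up to the data on `[0, 1]`, and `V` solves the equation of the generator of the capital process
(in units of the poverty line). -/
structure IsGeneratorPair (r κ lam α : ℝ) (V W : ℝ → ℝ) : Prop where
  continuousOn_left : ContinuousOn V (Set.Ici 1)
  continuousOn_right : ContinuousOn W (Set.Ici 1)
  bounded_left : ∃ M, ∀ u, 1 ≤ u → |V u| ≤ M
  bounded_right : ∃ M, ∀ u, 1 ≤ u → |W u| ≤ M
  hasDerivAt_left : ∀ u, 1 < u → HasDerivAt V ((κ * V u - lam * W u) / (r * (u - 1))) u
  hasDerivAt_right : ∀ u, 1 < u → HasDerivAt W (α * (V u - W u) / u) u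
  boundary : lam * W 1 = κ * V 1

/-- The extension of `V (x / xs)` from `x ≥ xs` to all `x`, by an affine function of slope `-B`
on `[0, xs]`. -/
noncomputable def extendedValue (xs B : ℝ) (V : ℝ → ℝ) (x : ℝ) : ℝ :=
  if x ≤ xs then V 1 + B * (xs - max x 0) else V (max (x / xs) 1)

/-- The `Beta(α, 1)`-average of `extendedValue`, as a function of `x / xs`. -/
noncomputable def extendedAverage (xs B α : ℝ) (V W : ℝ → ℝ) (u : ℝ) : ℝ :=
  if u ≤ 1 then V 1 + B * xs * (1 - u * (α / (α + 1))) else W (max u 1)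

section oneStep

variable {r κ lam α xs B δ : ℝ} {V W : ℝ → ℝ}

lemma continuous_comp_max_one {f : ℝ → ℝ} (hf : ContinuousOn f (Set.Ici 1)) {g : ℝ → ℝ}
    (hg : Continuous g) : Continuous fun u => f (max (g u) 1) :=
  hf.comp_continuous (by fun_prop) fun _ => Set.mem_Ici.2 (le_max_right _ _)

lemma continuous_extendedValue (hxs : 0 < xs) (hV : ContinuousOn V (Set.Ici 1)) :
    Continuous (extendedValue xs B V) := by
  refine Continuous.if_le (by fun_prop) (continuous_comp_max_one hV (by fun_prop))
    continuous_id continuous_const fun x hx => ?_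
  have hx' : x = xs := hx
  rw [hx', max_eq_left hxs.le, div_self hxs.ne', max_self]
  ring

lemma extendedValue_of_le {x : ℝ} (hx : x ≤ xs) :
    extendedValue xs B V x = V 1 + B * (xs - max x 0) := if_pos hx

lemma extendedValue_of_ge (hxs : 0 < xs) {x : ℝ} (hx : xs ≤ x) :
    extendedValue xs B V x = V (x / xs) := by
  rcases hx.eq_or_lt with rfl | h
  · rw [extendedValue_of_le le_rfl, max_eq_left hxs.le, div_self hxs.ne']
    ring
  · rw [extendedValue, if_neg h.not_ge, max_eq_left ((one_le_div hxs).2 hx)]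

lemma continuous_extendedAverage (hα : 0 < α) (hW : ContinuousOn W (Set.Ici 1))
    (hB : W 1 = V 1 + B * xs / (α + 1)) : Continuous (extendedAverage xs B α V W) := by
  refine Continuous.if_le (by fun_prop) (continuous_comp_max_one hW continuous_id)
    continuous_id continuous_const fun x hx => ?_
  have hx' : x = 1 := hx
  have : α + 1 ≠ 0 := by positivity
  rw [hx', max_self, hB]
  field_simp
  ring

lemma extendedAverage_of_ge (hα : 0 < α) (hB : W 1 = V 1 + B * xs / (α + 1)) {u : ℝ}
    (hu : 1 ≤ u) : extendedAverage xs B α V W u = W u := by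
  rcases hu.eq_or_lt with rfl | h
  · have : α + 1 ≠ 0 := by positivity
    rw [extendedAverage, if_pos le_rfl, hB]
    field_simp
    ring
  · rw [extendedAverage, if_neg h.not_ge, max_eq_left hu]

lemma abs_extendedValue_le (hxs : 0 < xs) {M : ℝ} (hM : ∀ u, 1 ≤ u → |V u| ≤ M) (x : ℝ) :
    |extendedValue xs B V x| ≤ M + |B| * xs := by
  rcases le_total x xs with h | h
  · rw [extendedValue_of_le h]
    refine (abs_add_le _ _).trans (add_le_add (hM 1 le_rfl) ?_)
    rw [abs_mul]
    refine mul_le_mul_of_nonneg_left ?_ (abs_nonneg _)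
    rw [abs_of_nonneg (sub_nonneg.2 (max_le h hxs.le))]
    linarith [le_max_right x 0]
  · rw [extendedValue_of_ge hxs h]
    exact (hM _ ((one_le_div hxs).2 h)).trans (le_add_of_nonneg_right (by positivity))

/-- Supplies the antiderivative of the integrand in the Beta-average. The kink where `y * z` crosses
`xs` is excluded; continuity there suffices for the fundamental theorem of calculus. -/
lemma hasDerivAt_rpow_mul_extendedAverage (hα : 0 < α) (hxs : 0 < xs)
    (hVW : IsGeneratorPair r κ lam α V W) {y z : ℝ}
    (hy : 0 < y) (hz : 0 < z) (hne : z ≠ xs / y) :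
    HasDerivAt (fun z => z ^ α * extendedAverage xs B α V W (y * z / xs))
      (α * z ^ (α - 1) * extendedValue xs B V (y * z)) z := by
  have hzα : HasDerivAt (fun z : ℝ => z ^ α) (α * z ^ (α - 1)) z :=
    Real.hasDerivAt_rpow_const (Or.inl hz.ne')
  have hlin : HasDerivAt (fun z : ℝ => y * z / xs) (y / xs) z := by
    simpa using ((hasDerivAt_id z).const_mul y).div_const xs
  have hpow : z ^ α = z ^ (α - 1) * z := by
    rw [Real.rpow_sub_one hz.ne']; field_simp
  have hα1 : α + 1 ≠ 0 := by positivity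
  have hcont : ContinuousAt (fun z : ℝ => y * z / xs) z := hlin.continuousAt
  rcases hne.lt_or_gt with h | h
  · have hlt : y * z / xs < 1 := by
      rw [div_lt_one hxs]
      rw [lt_div_iff₀ hy] at h
      linarith
    have hle : y * z ≤ xs := by rw [div_lt_one hxs] at hlt; exact hlt.le
    have h1 := hzα.mul (((hlin.mul_const (α / (α + 1))).const_sub 1).const_mul (B * xs)
      |>.const_add (V 1))
    refine (h1.congr_deriv ?_).congr_of_eventuallyEq ?_
    · rw [extendedValue_of_le hle, max_eq_left (by positivity), hpow]
      field_simp
      ring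
    · filter_upwards [hcont.eventually_lt_const hlt] with w hw
      rw [extendedAverage, if_pos hw.le]
      rfl
  · have hgt : 1 < y * z / xs := by
      rw [one_lt_div hxs]
      rw [div_lt_iff₀ hy] at h
      linarith
    have hle : xs ≤ y * z := by rw [one_lt_div hxs] at hgt; exact hgt.le
    have h1 := hzα.mul ((hVW.hasDerivAt_right _ hgt).comp z hlin)
    refine (h1.congr_deriv ?_).congr_of_eventuallyEq ?_
    · rw [extendedValue_of_ge hxs hle, hpow, Function.comp_apply]
      field_simp
      ring
    · filter_upwards [hcont.eventually_const_lt hgt] with w hw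
      rw [extendedAverage, if_neg hw.not_ge, max_eq_left hw.le]
      rfl

lemma integral_betaMeasure_extendedValue (hα : 0 < α) (hxs : 0 < xs)
    (hVW : IsGeneratorPair r κ lam α V W) (hB : W 1 = V 1 + B * xs / (α + 1)) {y : ℝ}
    (hy : xs ≤ y) : ∫ z, extendedValue xs B V (y * z) ∂(betaMeasure α 1) = W (y / xs) := by
  have hy0 : 0 < y := hxs.trans_le hy
  have hcont := continuous_extendedValue (B := B) hxs hVW.continuousOn_left
  have hcontA := continuous_extendedAverage hα hVW.continuousOn_right hB
  rw [integral_betaMeasure_one hα, integral_eq_of_hasDerivAt_off_countable_of_le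
    (fun z => z ^ α * extendedAverage xs B α V W (y * z / xs)) _ zero_le_one
    (Set.countable_singleton (xs / y))]
  · rw [Real.one_rpow, Real.zero_rpow hα.ne', mul_one, one_mul, zero_mul, sub_zero,
      extendedAverage_of_ge hα hB ((one_le_div hxs).2 hy)]
  · refine Continuous.continuousOn ?_
    exact (Real.continuous_rpow_const hα.le).mul (hcontA.comp (by fun_prop))
  · exact fun z hz => hasDerivAt_rpow_mul_extendedAverage hα hxs hVW hy0 hz.1.1 hz.2
  · refine IntervalIntegrable.mul_continuousOn ?_ (hcont.comp (by fun_prop)).continuousOn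
    exact (intervalIntegral.intervalIntegrable_rpow' (by linarith)).const_mul _

/-- Along the flow, `-exp (-(δ + lam) t) * V` has derivative `lam * exp (-(δ + lam) t) * W`, and it
tends to `0` because `V` is bounded. -/
lemma integral_expMeasure_flow (hr : 0 < r) (hlam : 0 < lam) (hδ : 0 < δ)
    (hVW : IsGeneratorPair r (δ + lam) lam α V W) {u : ℝ} (hu : 1 ≤ u) :
    ∫ t, Real.exp (-δ * t) * W ((u - 1) * Real.exp (r * t) + 1) ∂(expMeasure lam) = V u := by
  have hge : ∀ t, 1 ≤ (u - 1) * Real.exp (r * t) + 1 := fun t =>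
    le_add_of_nonneg_left (mul_nonneg (by linarith) (Real.exp_pos _).le)
  have hκ : 0 < δ + lam := by linarith
  have hexp : ∀ t, HasDerivAt (fun t => Real.exp (-(δ + lam) * t))
      (-(δ + lam) * Real.exp (-(δ + lam) * t)) t := fun t => by
    simpa [mul_comm] using ((hasDerivAt_id t).const_mul (-(δ + lam))).exp
  have hderiv : ∀ t, HasDerivAt
      (fun t => -(Real.exp (-(δ + lam) * t) * V ((u - 1) * Real.exp (r * t) + 1)))
      (Real.exp (-(δ + lam) * t) * (lam * W ((u - 1) * Real.exp (r * t) + 1))) t := by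
    intro t
    -- At `u = 1` the flow is stationary and `V` need not be differentiable; the boundary condition
    -- takes the place of the differential equation.
    rcases hu.eq_or_lt with rfl | h
    · simp only [sub_self, zero_mul, zero_add]
      refine ((hexp t).mul_const (V 1)).neg.congr_deriv ?_
      rw [hVW.boundary]
      ring
    · have hpos : 0 < (u - 1) * Real.exp (r * t) := mul_pos (by linarith) (Real.exp_pos _)
      have h1 : HasDerivAt (fun t => (u - 1) * Real.exp (r * t) + 1)
          (r * ((u - 1) * Real.exp (r * t))) t := by
        have := (((hasDerivAt_id t).const_mul r).exp.const_mul (u - 1)).add_const 1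
        refine this.congr_deriv ?_
        simp only [id, mul_one]
        ring
      have h2 := ((hexp t).mul ((hVW.hasDerivAt_left _ (lt_add_of_pos_left 1 hpos)).comp t h1)).neg
      refine h2.congr_deriv ?_
      have hu1 : u - 1 ≠ 0 := by linarith
      simp only [Function.comp_apply, add_sub_cancel_right]
      field_simp
      ring
  obtain ⟨MV, hMV⟩ := hVW.bounded_left
  obtain ⟨MW, hMW⟩ := hVW.bounded_right
  have hint0 := integrableOn_exp_mul_Ioi (neg_lt_zero.2 hκ) 0
  have hcontW : Continuous fun t => W ((u - 1) * Real.exp (r * t) + 1) :=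
    hVW.continuousOn_right.comp_continuous (by fun_prop) hge
  have hint : IntegrableOn
      (fun t => Real.exp (-(δ + lam) * t) * (lam * W ((u - 1) * Real.exp (r * t) + 1)))
      (Set.Ioi 0) := by
    refine Integrable.mul_bdd (c := lam * MW) hint0
      (hcontW.const_mul lam).aestronglyMeasurable (Eventually.of_forall fun t => ?_)
    rw [Real.norm_eq_abs, abs_mul, abs_of_pos hlam]
    exact mul_le_mul_of_nonneg_left (hMW _ (hge t)) hlam.le
  have hlim : Tendsto
      (fun t => -(Real.exp (-(δ + lam) * t) * V ((u - 1) * Real.exp (r * t) + 1)))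
      atTop (𝓝 0) := by
    have h0 : Tendsto (fun t => Real.exp (-(δ + lam) * t) * MV) atTop (𝓝 0) := by
      have := (Real.tendsto_exp_atBot.comp
        (tendsto_id.const_mul_atTop_of_neg (neg_lt_zero.2 hκ))).mul_const MV
      rw [zero_mul] at this
      exact this
    refine squeeze_zero_norm (fun t => ?_) h0
    rw [norm_neg, Real.norm_eq_abs, abs_mul, abs_of_pos (Real.exp_pos _)]
    exact mul_le_mul_of_nonneg_left (hMV _ (hge t)) (Real.exp_pos _).le
  rw [integral_expMeasure hlam]
  have key := integral_Ioi_of_hasDerivAt_of_tendsto' (fun t _ => hderiv t) hint hlim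
  simp only [mul_zero, Real.exp_zero, mul_one, sub_add_cancel, one_mul, sub_neg_eq_add,
    zero_add] at key
  rw [← key]
  refine integral_congr_ae (Eventually.of_forall fun t => ?_)
  simp only
  rw [show -(δ + lam) * t = -(lam * t) + -δ * t by ring, Real.exp_add]
  ring

/-- One-step equation for the capital process: `extendedValue` is the transfer, weighted by `B`,
plus its discounted expected value just after the next loss. -/
lemma extendedValue_eq_add_integral (hr : 0 < r) (hlam : 0 < lam) (hδ : 0 < δ) (hα : 0 < α)
    (hxs : 0 < xs) (hVW : IsGeneratorPair r (δ + lam) lam α V W)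
    (hB : W 1 = V 1 + B * xs / (α + 1)) (x : ℝ) :
    extendedValue xs B V x = B * max (xs - max x 0) 0 +
      ∫ t, ∫ z, Real.exp (-δ * t) * extendedValue xs B V (capitalFlow r xs (max x xs) t * z)
        ∂(betaMeasure α 1) ∂(expMeasure lam) := by
  have hflow : ∀ t, capitalFlow r xs (max x xs) t = (max x xs - xs) * Real.exp (r * t) + xs := by
    intro t
    rw [capitalFlow]
    split_ifs with h
    · rfl
    · rw [le_antisymm (not_lt.1 h) (le_max_right _ _)]
      ring
  have hx : xs ≤ max x xs := le_max_right _ _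
  have hge : ∀ t, xs ≤ (max x xs - xs) * Real.exp (r * t) + xs := fun t =>
    le_add_of_nonneg_left (mul_nonneg (by linarith) (Real.exp_pos _).le)
  have hdiv : ∀ t, ((max x xs - xs) * Real.exp (r * t) + xs) / xs =
      (max x xs / xs - 1) * Real.exp (r * t) + 1 := fun t => by
    field_simp
  simp only [hflow, integral_const_mul,
    integral_betaMeasure_extendedValue hα hxs hVW hB (hge _), hdiv]
  rw [integral_expMeasure_flow hr hlam hδ hVW ((one_le_div hxs).2 hx)]
  rcases le_total x xs with h | h
  · rw [extendedValue_of_le h, max_eq_right h, div_self hxs.ne',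
      max_eq_left (sub_nonneg.2 (max_le h hxs.le))]
    ring
  · rw [extendedValue_of_ge hxs h, max_eq_left h, max_eq_left (hxs.le.trans h),
      max_eq_right (sub_nonpos.2 h)]
    ring

end oneStep

/-! ### Regrouping independent variables -/

lemma comap_prodMk_eq_generateFrom {Ω A B : Type*} [MeasurableSpace A]
    [MeasurableSpace B] (f : Ω → A × B) :
    MeasurableSpace.comap f Prod.instMeasurableSpace = MeasurableSpace.generateFrom
      {s | ∃ t ∈ Set.image2 (· ×ˢ ·) {s : Set A | MeasurableSet s} {t : Set B | MeasurableSet t},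
        f ⁻¹' t = s} := by
  rw [← generateFrom_prod, MeasurableSpace.comap_generateFrom]
  rfl

/-- Regrouping of four variables that are independent in two stages. -/
lemma ProbabilityTheory.IndepFun.prodMk_prodMk_comm {Ω A B C D : Type*} [MeasurableSpace Ω]
    [MeasurableSpace A] [MeasurableSpace B] [MeasurableSpace C] [MeasurableSpace D]
    {P : Measure Ω} [IsProbabilityMeasure P] {U : Ω → A} {T : Ω → B} {Y : Ω → C} {Z : Ω → D}
    (hU : Measurable U) (hT : Measurable T) (hY : Measurable Y) (hZ : Measurable Z)
    (h : IndepFun (fun ω => (U ω, T ω)) (fun ω => (Y ω, Z ω)) P)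
    (hUT : IndepFun U T P) (hYZ : IndepFun Y Z P) :
    IndepFun (fun ω => (U ω, Y ω)) (fun ω => (T ω, Z ω)) P := by
  have hUY : IndepFun U Y P := h.comp measurable_fst measurable_fst
  have hTZ : IndepFun T Z P := h.comp measurable_snd measurable_snd
  rw [IndepFun_iff_Indep]
  refine IndepSets.indep (hU.prodMk hY).comap_le (hT.prodMk hZ).comap_le
    (isPiSystem_prod.comap _) (isPiSystem_prod.comap _) (comap_prodMk_eq_generateFrom _)
    (comap_prodMk_eq_generateFrom _) ?_
  rw [IndepSets_iff]
  rintro _ _ ⟨_, ⟨a, ha, c, hc, rfl⟩, rfl⟩ ⟨_, ⟨b, hb, d, hd, rfl⟩, rfl⟩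
  simp only [Set.mk_preimage_prod]
  have h1 := h.measure_inter_preimage_eq_mul _ _ (MeasurableSet.prod ha hb)
    (MeasurableSet.prod hc hd)
  simp only [Set.mk_preimage_prod] at h1
  rw [Set.inter_inter_inter_comm, h1, hUT.measure_inter_preimage_eq_mul _ _ ha hb,
    hYZ.measure_inter_preimage_eq_mul _ _ hc hd, hUY.measure_inter_preimage_eq_mul _ _ ha hc,
    hTZ.measure_inter_preimage_eq_mul _ _ hb hd]
  ring

/-! ### Measurability, signs and the discount factor of one step -/

lemma measurable_capitalFlow (r xs : ℝ) :
    Measurable fun p : ℝ × ℝ => capitalFlow r xs p.1 p.2 := by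
  unfold capitalFlow
  exact Measurable.ite (measurableSet_lt measurable_const measurable_fst) (by fun_prop)
    (by fun_prop)

lemma le_capitalFlow {r xs y : ℝ} (hy : xs ≤ y) (s : ℝ) : xs ≤ capitalFlow r xs y s := by
  unfold capitalFlow
  split_ifs with h
  · exact le_add_of_nonneg_left (mul_nonneg (by linarith) (Real.exp_pos _).le)
  · exact hy

lemma ae_nonneg_expMeasure {lam : ℝ} : ∀ᵐ t ∂(expMeasure lam), 0 ≤ t := by
  rw [ae_iff, expMeasure, gammaMeasure, withDensity_apply _ (by measurability)]
  refine setLIntegral_eq_zero (by measurability) fun t ht => ?_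
  exact gammaPDF_of_neg (not_le.1 ht)

lemma ae_nonneg_betaMeasure {α β : ℝ} : ∀ᵐ z ∂(betaMeasure α β), 0 ≤ z := by
  rw [ae_iff, betaMeasure, withDensity_apply _ (by measurability)]
  refine setLIntegral_eq_zero (by measurability) fun t ht => ?_
  exact betaPDF_eq_zero_of_nonpos (not_le.1 ht).le

lemma integral_exp_expMeasure {lam δ : ℝ} (hlam : 0 < lam) (hδ : 0 < δ) :
    ∫ t, Real.exp (-δ * t) ∂(expMeasure lam) = lam / (lam + δ) := by
  rw [integral_expMeasure hlam]
  have h : ∀ t, lam * Real.exp (-(lam * t)) * Real.exp (-δ * t) =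
      lam * Real.exp (-(lam + δ) * t) := fun t => by
    rw [mul_assoc, ← Real.exp_add]
    ring_nf
  simp only [h]
  rw [integral_const_mul, integral_exp_mul_Ioi (by linarith)]
  simp only [mul_zero, Real.exp_zero]
  field_simp

/-! ### The capital chain and iteration of the one-step equation -/

/-- The capital before the `n`-th transfer as a random variable. -/
noncomputable def capital {Ω : Type*} (r xs x : ℝ) (τ Z : ℕ → Ω → ℝ) (n : ℕ) (ω : Ω) : ℝ :=
  capitalBeforeTransfer r xs (fun k => τ k ω) (fun k => Z k ω) x n

lemma capital_succ {Ω : Type*} (r xs x : ℝ) (τ Z : ℕ → Ω → ℝ) (n : ℕ) (ω : Ω) :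
    capital r xs x τ Z (n + 1) ω =
      capitalFlow r xs (max (capital r xs x τ Z n ω) xs) (τ (n + 1) ω - τ n ω) * Z n ω := rfl

namespace IsLossModel

variable {Ω : Type*} [MeasurableSpace Ω] {P : Measure Ω} {lam : ℝ} {ν : Measure ℝ}
  {τ Z : ℕ → Ω → ℝ}

lemma exists_measurable_past (h : IsLossModel P lam ν τ Z) (r xs x : ℝ) (n : ℕ) :
    ∃ Φ : (Finset.range n → ℝ) × (Finset.range n → ℝ) → ℝ × ℝ, Measurable Φ ∧
      ∀ ω, (τ n ω, capital r xs x τ Z n ω) =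
        Φ (fun i => τ (i + 1) ω - τ i ω, fun i => Z i ω) := by
  induction n with
  | zero =>
    exact ⟨fun _ => (0, x), measurable_const, fun ω => by rw [h.time_zero]; rfl⟩
  | succ n ih =>
    obtain ⟨Φ, hΦ, hΦeq⟩ := ih
    have hsub : ∀ i : Finset.range n, (i : ℕ) ∈ Finset.range (n + 1) := fun i =>
      Finset.range_subset_range.2 n.le_succ i.2
    have hn : n ∈ Finset.range (n + 1) := Finset.self_mem_range_succ n
    let R : (Finset.range (n + 1) → ℝ) → Finset.range n → ℝ := fun u i => u ⟨i, hsub i⟩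
    have hR : Measurable R := measurable_pi_lambda _ fun i => measurable_pi_apply _
    have hprev : Measurable fun p : (Finset.range (n + 1) → ℝ) × (Finset.range (n + 1) → ℝ) =>
        Φ (R p.1, R p.2) := hΦ.comp ((hR.comp measurable_fst).prodMk (hR.comp measurable_snd))
    have hu : Measurable fun p : (Finset.range (n + 1) → ℝ) × (Finset.range (n + 1) → ℝ) =>
        p.1 ⟨n, hn⟩ := (measurable_pi_apply _).comp measurable_fst
    have hz : Measurable fun p : (Finset.range (n + 1) → ℝ) × (Finset.range (n + 1) → ℝ) =>
        p.2 ⟨n, hn⟩ := (measurable_pi_apply _).comp measurable_snd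
    refine ⟨fun p => ((Φ (R p.1, R p.2)).1 + p.1 ⟨n, hn⟩,
      capitalFlow r xs (max (Φ (R p.1, R p.2)).2 xs) (p.1 ⟨n, hn⟩) * p.2 ⟨n, hn⟩), ?_, ?_⟩
    · refine (hprev.fst.add hu).prodMk (Measurable.mul ?_ hz)
      exact (measurable_capitalFlow r xs).comp ((hprev.snd.max measurable_const).prodMk hu)
    · intro ω
      have hΦω : Φ (R fun i => τ (i + 1) ω - τ i ω, R fun i => Z i ω) =
          (τ n ω, capital r xs x τ Z n ω) := (hΦeq ω).symm
      simp only [hΦω, capital_succ, add_sub_cancel]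

lemma measurable_capital (h : IsLossModel P lam ν τ Z) (r xs x : ℝ) (n : ℕ) :
    Measurable (capital r xs x τ Z n) := by
  obtain ⟨Φ, hΦ, hΦeq⟩ := h.exists_measurable_past r xs x n
  have : capital r xs x τ Z n = fun ω =>
      (Φ (fun i => τ (i + 1) ω - τ i ω, fun i => Z i ω)).2 := by
    ext ω; rw [← hΦeq]
  rw [this]
  exact (hΦ.comp ((measurable_pi_lambda _ fun i =>
    (h.measurable_time _).sub (h.measurable_time _)).prodMk
    (measurable_pi_lambda _ fun i => h.measurable_remaining _))).snd

/-- The model separates times from proportions, whereas the Markov step needs past separated from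
future; the four blocks are regrouped accordingly. -/
lemma indepFun_past [IsProbabilityMeasure P] (h : IsLossModel P lam ν τ Z) (r xs x : ℝ) (n : ℕ) :
    IndepFun (fun ω => (τ n ω, capital r xs x τ Z n ω))
      (fun ω => (τ (n + 1) ω - τ n ω, Z n ω)) P := by
  obtain ⟨Φ, hΦ, hΦeq⟩ := h.exists_measurable_past r xs x n
  have hT : ∀ i, Measurable fun ω => τ (i + 1) ω - τ i ω := fun i =>
    (h.measurable_time _).sub (h.measurable_time _)
  have hdisj : Disjoint (Finset.range n) {n} := by simp
  have hev : Measurable fun v : ({n} : Finset ℕ) → ℝ => v ⟨n, Finset.mem_singleton_self n⟩ :=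
    measurable_pi_apply _
  have h1 := (h.waiting_indep.indepFun_finset _ _ hdisj hT).comp measurable_id hev
  have h2 := (h.remaining_indep.indepFun_finset _ _ hdisj h.measurable_remaining).comp
    measurable_id hev
  have m1 : Measurable fun t : ℕ → ℝ =>
      ((fun i : Finset.range n => t (i + 1) - t i), t (n + 1) - t n) := by fun_prop
  have m2 : Measurable fun z : ℕ → ℝ => ((fun i : Finset.range n => z i), z n) := by fun_prop
  have h3 := (h.indep.comp m1 m2).prodMk_prodMk_comm (U := fun ω (i : Finset.range n) =>
    τ (i + 1) ω - τ i ω) (Y := fun ω (i : Finset.range n) => Z i ω)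
    (measurable_pi_lambda _ fun i => hT i) (hT n)
    (measurable_pi_lambda _ fun i => h.measurable_remaining i) (h.measurable_remaining n) h1 h2
  simp only [hΦeq]
  exact h3.comp hΦ measurable_id

lemma map_past_step [IsProbabilityMeasure P] (h : IsLossModel P lam ν τ Z) (r xs x : ℝ) (n : ℕ) :
    P.map (fun ω => ((τ n ω, capital r xs x τ Z n ω), (τ (n + 1) ω - τ n ω, Z n ω))) =
      (P.map fun ω => (τ n ω, capital r xs x τ Z n ω)).prod ((expMeasure lam).prod ν) := by
  have hT : Measurable fun ω => τ (n + 1) ω - τ n ω :=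
    (h.measurable_time _).sub (h.measurable_time _)
  have hZ := h.measurable_remaining n
  have hX := (h.measurable_time n).prodMk (h.measurable_capital r xs x n)
  have hTZ : IndepFun (fun ω => τ (n + 1) ω - τ n ω) (Z n) P :=
    h.indep.comp (φ := fun t : ℕ → ℝ => t (n + 1) - t n) (ψ := fun z : ℕ → ℝ => z n)
      (by fun_prop) (by fun_prop)
  rw [(indepFun_iff_map_prod_eq_prod_map_map hX.aemeasurable (hT.prodMk hZ).aemeasurable).1
    (h.indepFun_past r xs x n),
    (indepFun_iff_map_prod_eq_prod_map_map hT.aemeasurable hZ.aemeasurable).1 hTZ,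
    (h.waiting_law n).map_eq, (h.remaining_law n).map_eq]

lemma ae_time_nonneg (h : IsLossModel P lam ν τ Z) : ∀ᵐ ω ∂P, ∀ n, 0 ≤ τ n ω := by
  have hw : ∀ᵐ ω ∂P, ∀ n, 0 ≤ τ (n + 1) ω - τ n ω := ae_all_iff.2 fun n =>
    ((h.waiting_law n).ae_iff (p := fun t => 0 ≤ t) (measurableSet_setOfPred.1 measurableSet_Ici)).2
      ae_nonneg_expMeasure
  filter_upwards [hw] with ω hω n
  induction n with
  | zero => exact (h.time_zero ω).ge
  | succ n ih => linarith [hω n]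

lemma ae_capital_nonneg (h : IsLossModel P lam ν τ Z) (hν : ∀ᵐ z ∂ν, 0 ≤ z) {r xs x : ℝ}
    (hxs : 0 ≤ xs) (hx : 0 ≤ x) : ∀ᵐ ω ∂P, ∀ n, 0 ≤ capital r xs x τ Z n ω := by
  have hw : ∀ᵐ ω ∂P, ∀ n, 0 ≤ Z n ω := ae_all_iff.2 fun n =>
    ((h.remaining_law n).ae_iff (p := fun t => 0 ≤ t)
      (measurableSet_setOfPred.1 measurableSet_Ici)).2 hν
  filter_upwards [hw] with ω hω n
  cases n with
  | zero => exact hx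
  | succ n =>
    rw [capital_succ]
    exact mul_nonneg (hxs.trans (le_capitalFlow (le_max_right _ _) _)) (hω n)

lemma integrable_discounted [IsProbabilityMeasure P] (h : IsLossModel P lam ν τ Z) {δ : ℝ}
    (hδ : 0 ≤ δ) (r xs x : ℝ) {f : ℝ → ℝ} (hf : Measurable f) {M : ℝ} (hM : ∀ y, |f y| ≤ M)
    (n : ℕ) : Integrable (fun ω => Real.exp (-δ * τ n ω) * f (capital r xs x τ Z n ω)) P := by
  have hτ := h.measurable_time n
  have hX := hf.comp (h.measurable_capital r xs x n)
  refine Integrable.of_bound (C := M) (Measurable.aestronglyMeasurable ?_) ?_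
  · exact Measurable.mul (by fun_prop) hX
  · filter_upwards [h.ae_time_nonneg] with ω hω
    rw [Real.norm_eq_abs, abs_mul, abs_of_pos (Real.exp_pos _)]
    refine (mul_le_of_le_one_left (abs_nonneg _) ?_).trans (hM _)
    exact Real.exp_le_one_iff.2 (mul_nonpos_of_nonpos_of_nonneg (by linarith) (hω n))

/-- Markov property: the discount factor splits over the last waiting time, and Fubini applies to
the product law of the past and the next step. -/
lemma integral_discounted_succ [IsProbabilityMeasure P] [IsProbabilityMeasure ν]
    (h : IsLossModel P lam ν τ Z) (hlam : 0 < lam)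
    {δ : ℝ} (hδ : 0 ≤ δ) (r xs x : ℝ) {G : ℝ → ℝ} (hG : Measurable G) {M : ℝ}
    (hM : ∀ y, |G y| ≤ M) (n : ℕ) :
    ∫ ω, Real.exp (-δ * τ (n + 1) ω) * G (capital r xs x τ Z (n + 1) ω) ∂P =
      ∫ ω, Real.exp (-δ * τ n ω) * ∫ t, ∫ z, Real.exp (-δ * t) *
        G (capitalFlow r xs (max (capital r xs x τ Z n ω) xs) t * z) ∂ν ∂(expMeasure lam) ∂P := by
  have := isProbabilityMeasure_expMeasure hlam
  have hT : Measurable fun ω => τ (n + 1) ω - τ n ω :=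
    (h.measurable_time _).sub (h.measurable_time _)
  have hX := (h.measurable_time n).prodMk (h.measurable_capital r xs x n)
  set J : Ω → (ℝ × ℝ) × (ℝ × ℝ) := fun ω =>
    ((τ n ω, capital r xs x τ Z n ω), (τ (n + 1) ω - τ n ω, Z n ω)) with hJdef
  have hJ : Measurable J := hX.prodMk (hT.prodMk (h.measurable_remaining n))
  have hQ : Measurable fun q : ℝ × ℝ × ℝ => Real.exp (-δ * q.2.1) *
      G (capitalFlow r xs (max q.1 xs) q.2.1 * q.2.2) := by
    refine Measurable.mul (by fun_prop) (hG.comp (Measurable.mul ?_ (by fun_prop)))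
    exact (measurable_capitalFlow r xs).comp
      ((measurable_fst.max measurable_const).prodMk measurable_snd.fst)
  set F : (ℝ × ℝ) × (ℝ × ℝ) → ℝ := fun p => Real.exp (-δ * p.1.1) *
    (Real.exp (-δ * p.2.1) * G (capitalFlow r xs (max p.1.2 xs) p.2.1 * p.2.2)) with hFdef
  have hF : Measurable F := Measurable.mul (by fun_prop)
    (hQ.comp (measurable_fst.snd.prodMk measurable_snd))
  have hFJ : ∀ ω, Real.exp (-δ * τ (n + 1) ω) * G (capital r xs x τ Z (n + 1) ω) = F (J ω) := by
    intro ω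
    simp only [hFdef, hJdef, capital_succ]
    rw [← mul_assoc, ← Real.exp_add]
    ring_nf
  have hint : Integrable F (P.map J) := by
    rw [integrable_map_measure hF.aestronglyMeasurable hJ.aemeasurable]
    exact (h.integrable_discounted hδ r xs x hG hM (n + 1)).congr (Eventually.of_forall hFJ)
  have hinner : ∀ y, Integrable (fun q : ℝ × ℝ => Real.exp (-δ * q.1) *
      G (capitalFlow r xs (max y xs) q.1 * q.2)) ((expMeasure lam).prod ν) := by
    intro y
    refine Integrable.of_bound (C := M)
      (hQ.comp (measurable_const.prodMk measurable_id)).aestronglyMeasurable ?_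
    have hfst : ∀ᵐ q ∂((expMeasure lam).prod ν), 0 ≤ q.1 :=
      Measure.quasiMeasurePreserving_fst.ae ae_nonneg_expMeasure
    filter_upwards [hfst] with q hq
    rw [Real.norm_eq_abs, abs_mul, abs_of_pos (Real.exp_pos _)]
    refine (mul_le_of_le_one_left (abs_nonneg _) ?_).trans (hM _)
    exact Real.exp_le_one_iff.2 (mul_nonpos_of_nonpos_of_nonneg (by linarith) hq)
  have hpm : IsProbabilityMeasure (P.map fun ω => (τ n ω, capital r xs x τ Z n ω)) :=
    Measure.isProbabilityMeasure_map hX.aemeasurable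
  simp only [hFJ]
  rw [← integral_map hJ.aemeasurable hF.aestronglyMeasurable]
  rw [hJdef, h.map_past_step] at hint ⊢
  rw [integral_prod _ hint, integral_map hX.aemeasurable
    hint.integral_prod_left.aestronglyMeasurable]
  refine integral_congr_ae (Eventually.of_forall fun ω => ?_)
  simp only [hFdef]
  rw [integral_const_mul, integral_prod _ (hinner _)]

lemma integral_exp_time [IsProbabilityMeasure P] [IsProbabilityMeasure ν]
    (h : IsLossModel P lam ν τ Z) (hlam : 0 < lam) {δ : ℝ} (hδ : 0 < δ) (n : ℕ) :
    ∫ ω, Real.exp (-δ * τ n ω) ∂P = (lam / (lam + δ)) ^ n := by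
  induction n with
  | zero => simp [h.time_zero]
  | succ n ih =>
    -- With `G = 1` the capital plays no role, so its parameters are set to `0`.
    have := h.integral_discounted_succ hlam hδ.le 0 0 0 (G := fun _ => 1) measurable_const
      (M := 1) (fun _ => by simp) n
    simp only [mul_one, integral_const, probReal_univ, smul_eq_mul, one_mul,
      integral_exp_expMeasure hlam hδ] at this
    rw [this, integral_mul_const, ih, pow_succ]

/-- A bounded solution `G` of the one-step equation with source `f` is the expected discounted sum
of the values of `f` along the capital process. -/
lemma tendsto_sum_integral_discounted [IsProbabilityMeasure P] [IsProbabilityMeasure ν]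
    (h : IsLossModel P lam ν τ Z) (hlam : 0 < lam)
    {δ : ℝ} (hδ : 0 < δ) (r xs x : ℝ) {G f : ℝ → ℝ} (hG : Measurable G) {M : ℝ}
    (hM : ∀ y, |G y| ≤ M) (hf : Measurable f) {M' : ℝ} (hM' : ∀ y, |f y| ≤ M')
    (hstep : ∀ y, G y = f y + ∫ t, ∫ z, Real.exp (-δ * t) *
        G (capitalFlow r xs (max y xs) t * z) ∂ν ∂(expMeasure lam)) :
    Tendsto (fun N => ∑ n ∈ Finset.range N,
      ∫ ω, Real.exp (-δ * τ n ω) * f (capital r xs x τ Z n ω) ∂P) atTop (𝓝 (G x)) := by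
  have hGi := h.integrable_discounted hδ.le r xs x hG hM
  have hfi := h.integrable_discounted hδ.le r xs x hf hM'
  have hsum : ∀ N, ∑ n ∈ Finset.range N,
      ∫ ω, Real.exp (-δ * τ n ω) * f (capital r xs x τ Z n ω) ∂P =
      G x - ∫ ω, Real.exp (-δ * τ N ω) * G (capital r xs x τ Z N ω) ∂P := by
    intro N
    induction N with
    | zero => simp [h.time_zero, capital, capitalBeforeTransfer]
    | succ N ih =>
      rw [Finset.sum_range_succ, ih, h.integral_discounted_succ hlam hδ.le r xs x hG hM N]
      have : ∀ ω, Real.exp (-δ * τ N ω) * ∫ t, ∫ z, Real.exp (-δ * t) *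
          G (capitalFlow r xs (max (capital r xs x τ Z N ω) xs) t * z) ∂ν ∂(expMeasure lam) =
          Real.exp (-δ * τ N ω) * G (capital r xs x τ Z N ω) -
          Real.exp (-δ * τ N ω) * f (capital r xs x τ Z N ω) := fun ω => by
        rw [hstep (capital r xs x τ Z N ω)]
        ring
      simp only [this]
      rw [integral_sub (hGi N) (hfi N)]
      ring
  have hρ : Tendsto (fun N : ℕ => (lam / (lam + δ)) ^ N * M) atTop (𝓝 0) := by
    have := (tendsto_pow_atTop_nhds_zero_of_lt_one (r := lam / (lam + δ)) (by positivity)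
      ((div_lt_one (by positivity)).2 (by linarith))).mul_const M
    rwa [zero_mul] at this
  have hrem : Tendsto (fun N => ∫ ω, Real.exp (-δ * τ N ω) * G (capital r xs x τ Z N ω) ∂P)
      atTop (𝓝 0) := by
    refine squeeze_zero_norm (fun N => ?_) hρ
    rw [← h.integral_exp_time hlam hδ N, ← integral_mul_const]
    have hexp := h.integrable_discounted hδ.le r xs x (f := fun _ => M) measurable_const
      (M := |M|) (fun _ => le_rfl) N
    refine norm_integral_le_of_norm_le hexp (Eventually.of_forall fun ω => ?_)
    rw [Real.norm_eq_abs, abs_mul, abs_of_pos (Real.exp_pos _)]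
    exact mul_le_mul_of_nonneg_left (hM _) (Real.exp_pos _).le
  simp only [hsum]
  simpa using tendsto_const_nhds.sub hrem

end IsLossModel

/-! ### The hypergeometric solution and the closed form -/

lemma isGeneratorPair_rpowSeries {r κ lam α b m : ℝ} {c : ℕ → ℝ} (hr : 0 < r) (hlam : 0 < lam)
    (hb : 0 ≤ b) (hsum : Summable c)
    (hroot : ∀ n : ℕ, (α - (b + n)) * (r * (b + n) + κ) = lam * α - r * ((m - 1 + n) * n))
    (hc : ∀ n : ℕ, c (n + 1) * ((m + n) * (n + 1)) = c n * ((b + n) * (b - α + 1 + n))) :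
    IsGeneratorPair r κ lam α (rpowSeries b c) (rpowSeries b (generatorCoeff r κ lam b c)) := by
  have hg := sub_mul_generatorCoeff hlam.ne' hroot hc
  have hgs := summable_generatorCoeff hsum hg
  refine ⟨continuousOn_rpowSeries hb hsum, continuousOn_rpowSeries hb hgs,
    ⟨_, fun u hu => abs_rpowSeries_le hb hsum hu⟩, ⟨_, fun u hu => abs_rpowSeries_le hb hgs hu⟩,
    fun u hu => ?_, fun u hu => ?_, ?_⟩
  · refine (hasDerivAt_rpowSeries hb hsum hu).congr_deriv ?_
    have hu1 : 0 < u - 1 := by linarith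
    rw [rpowSeries_generatorCoeff hlam.ne' hb hsum hu]
    field_simp
    ring
  · refine (hasDerivAt_rpowSeries hb hgs hu).congr_deriv ?_
    have hu0 : 0 < u := by linarith
    rw [← mul_tsum_deriv_generatorCoeff hb hsum hg hu]
    field_simp
  · rw [rpowSeries_one, rpowSeries_one, tsum_generatorCoeff hlam.ne' hr.ne' hsum hgs]

/-- With `s = u⁻¹`, the power series `∑ c n * s ^ n` vanishes on `(0, 1)`, and its limit as `s → 0`
is `c 0`. -/
lemma apply_zero_eq_zero_of_rpowSeries_eq_zero {b : ℝ} {c : ℕ → ℝ} (hc : Summable c)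
    (h : ∀ u, 1 < u → rpowSeries b c u = 0) : c 0 = 0 := by
  have hcont : ContinuousOn (fun s : ℝ => ∑' n, c n * s ^ n) (Set.Icc 0 1) := by
    refine continuousOn_tsum (fun n => by fun_prop) hc.abs fun n s hs => ?_
    rw [Real.norm_eq_abs, abs_mul, abs_of_nonneg (pow_nonneg hs.1 n)]
    exact mul_le_of_le_one_right (abs_nonneg _) (pow_le_one₀ hs.1 hs.2)
  have h0 : (∑' n, c n * (0 : ℝ) ^ n) = c 0 := by
    rw [tsum_eq_single 0 fun n hn => by simp [hn]]
    simp
  have hlim : Tendsto (fun s : ℝ => ∑' n, c n * s ^ n) (𝓝[Set.Ioo 0 1] 0) (𝓝 (c 0)) := by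
    rw [← h0]
    exact (hcont 0 (by simp)).mono_left (nhdsWithin_mono _ Set.Ioo_subset_Icc_self)
  have hne : (𝓝[Set.Ioo (0 : ℝ) 1] 0).NeBot := by
    rw [nhdsWithin_Ioo_eq_nhdsGT zero_lt_one]
    infer_instance
  refine tendsto_nhds_unique hlim (tendsto_const_nhds.congr' ?_)
  filter_upwards [self_mem_nhdsWithin] with s hs
  have := h s⁻¹ ((one_lt_inv₀ hs.1).2 hs.2)
  rw [rpowSeries_eq (inv_pos.2 hs.1), inv_inv] at this
  exact ((mul_eq_zero.1 this).resolve_right (Real.rpow_pos_of_pos hs.1 _).ne').symm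

/-- If the expected discounted transfers sum up to `S`, then `S` is the cost of social
protection. -/
lemma IsLossModel.socialProtectionCost_eq_ofReal {Ω : Type*} [MeasurableSpace Ω] {P : Measure Ω}
    [IsProbabilityMeasure P] {lam : ℝ} {ν : Measure ℝ} {τ Z : ℕ → Ω → ℝ}
    (h : IsLossModel P lam ν τ Z) (hν : ∀ᵐ z ∂ν, 0 ≤ z) {r xs δ x : ℝ} (hxs : 0 ≤ xs)
    (hδ : 0 ≤ δ) (hx : 0 ≤ x) {S : ℝ}
    (hS : Tendsto (fun N => ∑ n ∈ Finset.range N, ∫ ω, Real.exp (-δ * τ n ω) *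
      max (xs - max (capital r xs x τ Z n ω) 0) 0 ∂P) atTop (𝓝 S)) :
    0 ≤ S ∧ socialProtectionCost P r xs δ τ Z x = ENNReal.ofReal S := by
  set e : ℕ → Ω → ℝ := fun n ω =>
    Real.exp (-δ * τ n ω) * max (xs - max (capital r xs x τ Z n ω) 0) 0 with he
  have he0 : ∀ n ω, 0 ≤ e n ω := fun n ω => mul_nonneg (Real.exp_pos _).le (le_max_right _ _)
  have hi : ∀ n, Integrable (e n) P := fun n => by
    refine h.integrable_discounted hδ r xs x (f := fun y => max (xs - max y 0) 0) (by fun_prop)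
      (M := xs) (fun y => ?_) n
    rw [abs_of_nonneg (le_max_right _ _)]
    exact max_le (by linarith [le_max_right y 0]) hxs
  have hE0 : ∀ n, 0 ≤ ∫ ω, e n ω ∂P := fun n => integral_nonneg (he0 n)
  have hsum : HasSum (fun n => ∫ ω, e n ω ∂P) S :=
    (hasSum_iff_tendsto_nat_of_nonneg hE0 S).2 hS
  refine ⟨hsum.nonneg hE0, ?_⟩
  rw [← hsum.tsum_eq, ENNReal.ofReal_tsum_of_nonneg hE0 hsum.summable]
  -- Truncating the capital at `0` keeps the source bounded; almost surely it changes nothing,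
  -- because the capital is nonnegative.
  have hae : (fun ω => ∑' n, ENNReal.ofReal (Real.exp (-δ * τ n ω) *
      transfer r xs (fun k => τ k ω) (fun k => Z k ω) x n)) =ᵐ[P]
      fun ω => ∑' n, ENNReal.ofReal (e n ω) := by
    filter_upwards [h.ae_capital_nonneg (r := r) hν hxs hx] with ω hω
    refine tsum_congr fun n => ?_
    simp only [he, max_eq_left (hω n)]
    rfl
  rw [socialProtectionCost, lintegral_congr_ae hae,
    lintegral_tsum fun n => (hi n).aemeasurable.ennreal_ofReal]
  exact tsum_congr fun n =>
    (ofReal_integral_eq_lintegral_ofReal (hi n) (Eventually.of_forall (he0 n))).symm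

theorem mainTheorem6 {Ω : Type*} [MeasurableSpace Ω] (P : Measure Ω) [IsProbabilityMeasure P]
    (r xs lam δ α : ℝ) (hr : 0 < r) (hxs : 0 < xs) (hlam : 0 < lam) (hδ : 0 < δ) (hα : 0 < α)
    (τ Z : ℕ → Ω → ℝ) (hmodel : IsLossModel P lam (betaMeasure α 1) τ Z)
    (a b c : ℝ)
    (ha : a = (-(δ + lam - α * r) - √((δ + lam - α * r) ^ 2 + 4 * r * α * δ)) / (2 * r))
    (hb : b = (-(δ + lam - α * r) + √((δ + lam - α * r) ^ 2 + 4 * r * α * δ)) / (2 * r))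
    (hc : c = α) :
    -- the hypergeometric series converges on `[0, 1]`, and its value at `1` is not zero
    (∀ s ∈ Set.Icc (0 : ℝ) 1,
      Summable fun n => ordinaryHypergeometricCoefficient b (b - c + 1) (b - a + 1) n * s ^ n) ∧
    ₂F₁ b (b - c + 1) (b - a + 1) (1 : ℝ) ≠ 0 ∧
    -- the cost of social protection is finite and is given by the closed form
    ∀ x : ℝ, 0 ≤ x →
      socialProtectionCost P r xs δ τ Z x ≠ ∞ ∧
      (x ≤ xs → (socialProtectionCost P r xs δ τ Z x).toReal =
        (xs - x) + lam * xs / ((α + 1) * δ)) ∧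
      (xs < x → (socialProtectionCost P r xs δ τ Z x).toReal =
        (₂F₁ b (b - c + 1) (b - a + 1) (xs / x) * lam * xs) /
          (₂F₁ b (b - c + 1) (b - a + 1) (1 : ℝ) * (α + 1) * δ) * (xs / x) ^ b) := by
  subst c
  have hprob := isProbabilityMeasureBeta hα one_pos
  set s : ℝ := δ + lam - α * r with hs
  set D : ℝ := √(s ^ 2 + 4 * r * α * δ) with hD
  have hpos : 0 < 4 * r * α * δ := by positivity
  have hDsq : D ^ 2 = s ^ 2 + 4 * r * α * δ := Real.sq_sqrt (by positivity)
  have hDpos : 0 < D := Real.sqrt_pos.2 (by positivity)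
  have hDs : s < D := by
    refine lt_of_le_of_lt (le_abs_self s) ?_
    rw [← Real.sqrt_sq_eq_abs]
    exact Real.sqrt_lt_sqrt (sq_nonneg s) (by linarith)
  have hb0 : 0 < b := by rw [hb]; exact div_pos (by linarith) (by linarith)
  have hrb : 2 * r * b = -s + D := by rw [hb]; field_simp
  have hra : 2 * r * a = -s - D := by rw [ha]; field_simp
  have hquad : r * b ^ 2 + s * b = α * δ := by
    have : 4 * r * (r * b ^ 2 + s * b) = 4 * r * (α * δ) := by
      linear_combination (2 * r * b + s + D) * hrb + hDsq
    exact mul_left_cancel₀ (by positivity) this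
  have hm : 0 < b - a + 1 := by
    have : 0 < 2 * r * (b - a) := by linarith
    have := pos_of_mul_pos_right this (by positivity)
    linarith
  -- The gap is `α - a - b = (δ + lam) / r`.
  have hpq : b + (b - α + 1) < b - a + 1 := by
    have : 0 < 2 * r * (α - a - b) := by linarith
    have := pos_of_mul_pos_right this (by positivity)
    linarith
  set co : ℕ → ℝ := ordinaryHypergeometricCoefficient b (b - α + 1) (b - a + 1) with hco
  have hrec := ordinaryHypergeometricCoefficient_succ_mul (p := b) (q := b - α + 1) hm
  have hsum : Summable co := summable_of_hypergeometric_ratio hm hpq hrec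
  have hF : ∀ y : ℝ, ₂F₁ b (b - α + 1) (b - a + 1) y = ∑' n, co n * y ^ n := fun y => by
    rw [ordinaryHypergeometric_eq_tsum]
    simp [hco]
  -- Both sides equal `lam * α - r (ρ - a) (ρ - b)` at `ρ = b + n`.
  have hroot : ∀ n : ℕ, (α - (b + n)) * (r * (b + n) + (δ + lam)) =
      lam * α - r * ((b - a + 1 - 1 + n) * n) := fun n => by
    linear_combination -hquad - (n : ℝ) / 2 * (hrb + hra)
  have hVW := isGeneratorPair_rpowSeries hr hlam hb0.le hsum hroot hrec
  set V := rpowSeries b co with hV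
  set W := rpowSeries b (generatorCoeff r (δ + lam) lam b co) with hW
  have hV1 : V 1 = ₂F₁ b (b - α + 1) (b - a + 1) (1 : ℝ) := by
    rw [hF, hV, rpowSeries_one]
    simp
  -- The only value compatible with both `lam * W 1 = (δ + lam) * V 1` and continuity of the average
  -- at `u = 1`. Its sign is not known here, hence the bounds with `|B|`.
  set B : ℝ := (α + 1) * δ * V 1 / (lam * xs) with hBdef
  have hB : W 1 = V 1 + B * xs / (α + 1) := by
    refine mul_left_cancel₀ hlam.ne' (hVW.boundary.trans ?_)
    rw [hBdef]
    field_simp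
    ring
  obtain ⟨M, hM⟩ := hVW.bounded_left
  have hlim := fun x => hmodel.tendsto_sum_integral_discounted hlam hδ r xs x
    (continuous_extendedValue (B := B) hxs hVW.continuousOn_left).measurable
    (abs_extendedValue_le hxs hM) (f := fun y => B * max (xs - max y 0) 0) (by fun_prop)
    (M' := |B| * xs) (fun y => by
      rw [abs_mul, abs_of_nonneg (le_max_right _ (0 : ℝ))]
      exact mul_le_mul_of_nonneg_left (max_le (by linarith [le_max_right y 0]) hxs.le)
        (abs_nonneg _))
    (extendedValue_eq_add_integral hr hlam hδ hα hxs hVW hB)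
  have hV1ne : V 1 ≠ 0 := by
    intro h0
    have hB0 : B = 0 := by rw [hBdef, h0, mul_zero, zero_div]
    have hzero : ∀ u, 1 < u → V u = 0 := by
      intro u hu
      have := hlim (u * xs)
      simp only [hB0, zero_mul, mul_zero, integral_zero, Finset.sum_const_zero] at this
      have := tendsto_nhds_unique this tendsto_const_nhds
      rwa [extendedValue_of_ge hxs (le_mul_of_one_le_left hxs.le hu.le),
        mul_div_cancel_right₀ _ hxs.ne'] at this
    have := apply_zero_eq_zero_of_rpowSeries_eq_zero hsum hzero
    simp [hco] at this
  have hBne : B ≠ 0 := by rw [hBdef]; positivity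
  refine ⟨fun y hy => ?_, hV1 ▸ hV1ne, fun x hx => ?_⟩
  · refine Summable.of_norm_bounded hsum.abs fun n => ?_
    rw [Real.norm_eq_abs, abs_mul, abs_of_nonneg (pow_nonneg hy.1 n)]
    exact mul_le_of_le_one_right (abs_nonneg _) (pow_le_one₀ hy.1 hy.2)
  have hcost : Tendsto (fun N => ∑ n ∈ Finset.range N, ∫ ω, Real.exp (-δ * τ n ω) *
      max (xs - max (capital r xs x τ Z n ω) 0) 0 ∂P) atTop
      (𝓝 (B⁻¹ * extendedValue xs B V x)) := by
    refine ((hlim x).const_mul B⁻¹).congr fun N => ?_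
    rw [Finset.mul_sum]
    refine Finset.sum_congr rfl fun n _ => ?_
    rw [← integral_const_mul]
    refine integral_congr_ae (Eventually.of_forall fun ω => ?_)
    simp only
    field_simp
  obtain ⟨hS, hCeq⟩ := hmodel.socialProtectionCost_eq_ofReal ae_nonneg_betaMeasure hxs.le hδ.le hx
    hcost
  rw [hCeq, ENNReal.toReal_ofReal hS]
  refine ⟨ENNReal.ofReal_ne_top, fun hle => ?_, fun hlt => ?_⟩
  · rw [extendedValue_of_le hle, max_eq_left hx, mul_add, inv_mul_cancel_left₀ hBne, hBdef]
    field_simp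
    ring
  · have hx0 : 0 < x := hxs.trans hlt
    rw [extendedValue_of_ge hxs hlt.le, hV, rpowSeries_eq (div_pos hx0 hxs), inv_div x xs, hF (xs / x),
      ← hV1, hBdef]
    field_simp
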